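/- Let $\Gamma$ and $\Delta$ be groups with $\Delta$ non-trivial, and let $G=(V,E)$ be a simplicial graph (no loops, no multiple edges; possibly infinite) with $V\neq\emptyset$, on which $\Gamma$ acts on the left by graph automorphisms. For $v\in V$ let $N(v)$ be the set of neighbours of $v$. Let $G(\Delta)$ be the graph product, that is, the quotient of the free product of copies $\Delta_{(v)}$ of $\Delta$, one for each $v\in V$, by the normal closure of all commutators $[g_{(v)},h_{(w)}]$ with $\{v,w\}\in E$ and $g,h\in\Delta$, where $g_{(v)}$ denotes the copy of $g$ in $\Delta_{(v)}$. Let $G(\Delta)\rtimes\Gamma$ be the graph wreath product, that is, the semidirect product for the action of $\Gamma$ on $G(\Delta)$ by the automorphisms $\gamma\cdot g_{(v)}=g_{(\gamma v)}$. A group is residually finite if each of its non-identity elements has non-trivial image under some homomorphism to a finite group. Then $G(\Delta)\rtimes\Gamma$ is residually finite if and only if the following three conditions all hold. 1. $\Gamma$ and $\Delta$ are residually finite. 2. Either $\Delta$ is abelian and for all neighbouring $v,w\in V$ there is a finite-index subgroup $K\leq\Gamma$ such that $w\notin Kv$; or for every $v\in V$ there is a finite-index subgroup $K\leq\Gamma$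 such that $Kv\cap N(v)=\emptyset$. 3. For all $v,w\in V$ that are distinct and not neighbouring there is a finite-index subgroup $K\leq\Gamma$ such that $Kw\cap(N(v)\cup\{v\})=\emptyset$. -/

import Mathlib

open scoped commutatorElement

/-- The commutativity relators `[g_(v), h_(w)]`, for `v, w` adjacent in `G` and `g, h` in `Δ`,
inside the free product of `V`-many copies of `Δ`. -/
def graphProductRelators {V : Type*} (G : SimpleGraph V) (Δ : Type*) [Group Δ] :
    Set (Monoid.CoprodI (fun _ : V => Δ)) :=
  {x | ∃ v w : V, G.Adj v w ∧ ∃ g h : Δ,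
    x = ⁅(Monoid.CoprodI.of (M := fun _ : V => Δ) (i := v) g),
         (Monoid.CoprodI.of (M := fun _ : V => Δ) (i := w) h)⁆}

/-- The graph product `G(Δ)`: the free product of `V`-many copies of `Δ` modulo the normal
closure of the commutativity relators. -/
abbrev GraphProduct {V : Type*} (G : SimpleGraph V) (Δ : Type*) [Group Δ] : Type _ :=
  Monoid.CoprodI (fun _ : V => Δ) ⧸ Subgroup.normalClosure (graphProductRelators G Δ)

namespace GraphProduct

/-- The canonical homomorphism `g ↦ g_(v)` from `Δ` to the copy of `Δ` at the vertex `v`. -/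
def of {V : Type*} (G : SimpleGraph V) (Δ : Type*) [Group Δ] (v : V) :
    Δ →* GraphProduct G Δ :=
  (QuotientGroup.mk' (Subgroup.normalClosure (graphProductRelators G Δ))).comp
    (Monoid.CoprodI.of (M := fun _ : V => Δ) (i := v))

theorem of_commutator {V : Type*} (G : SimpleGraph V) (Δ : Type*) [Group Δ] {v w : V}
    (hvw : G.Adj v w) (g h : Δ) : ⁅of G Δ v g, of G Δ w h⁆ = 1 := by
  have : (QuotientGroup.mk' (Subgroup.normalClosure (graphProductRelators G Δ)))
      ⁅(Monoid.CoprodI.of (M := fun _ : V => Δ) (i := v) g),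
         (Monoid.CoprodI.of (M := fun _ : V => Δ) (i := w) h)⁆ = 1 :=
    (QuotientGroup.eq_one_iff _).2
      (Subgroup.subset_normalClosure ⟨v, w, hvw, g, h, rfl⟩)
  rwa [map_commutatorElement] at this

/-- The endomorphism of `G(Δ)` induced by an adjacency-preserving self-map `f` of the vertices:
it sends `g_(v)` to `g_(f v)`. -/
def mapVertices {V : Type*} (G : SimpleGraph V) (Δ : Type*) [Group Δ] (f : V → V)
    (hf : ∀ v w, G.Adj v w → G.Adj (f v) (f w)) : GraphProduct G Δ →* GraphProduct G Δ :=
  QuotientGroup.lift _ (Monoid.CoprodI.lift fun v => of G Δ (f v)) (by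
    intro x hx
    refine (Subgroup.normalClosure_le_normal
      (N := (Monoid.CoprodI.lift fun v => of G Δ (f v)).ker) ?_) hx
    rintro _ ⟨v, w, hvw, g, h, rfl⟩
    rw [SetLike.mem_coe, MonoidHom.mem_ker, map_commutatorElement, Monoid.CoprodI.lift_of,
      Monoid.CoprodI.lift_of]
    exact of_commutator G Δ (hf v w hvw) g h)

theorem mapVertices_of {V : Type*} (G : SimpleGraph V) (Δ : Type*) [Group Δ] (f : V → V)
    (hf : ∀ v w, G.Adj v w → G.Adj (f v) (f w)) (v : V) (g : Δ) :
    mapVertices G Δ f hf (of G Δ v g) = of G Δ (f v) g := by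
  change Monoid.CoprodI.lift (fun v => of G Δ (f v)) (Monoid.CoprodI.of g) = _
  rw [Monoid.CoprodI.lift_of]

theorem hom_ext {V : Type*} {G : SimpleGraph V} {Δ : Type*} [Group Δ] {H : Type*} [Monoid H]
    {φ ψ : GraphProduct G Δ →* H} (h : ∀ v g, φ (of G Δ v g) = ψ (of G Δ v g)) : φ = ψ := by
  apply QuotientGroup.monoidHom_ext
  apply Monoid.CoprodI.ext_hom
  intro v
  ext g
  exact h v g

/-- The action of `Γ` on `G(Δ)` by group automorphisms, `γ · g_(v) = g_(γ • v)`, where `Γ` acts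
on `G` by graph automorphisms. -/
def action {V Γ : Type*} [Group Γ] [MulAction Γ V] (G : SimpleGraph V) (Δ : Type*) [Group Δ]
    (hG : ∀ (γ : Γ) (v w : V), G.Adj (γ • v) (γ • w) ↔ G.Adj v w) :
    Γ →* MulAut (GraphProduct G Δ) where
  toFun γ := MonoidHom.toMulEquiv
    (mapVertices G Δ (γ • ·) fun v w => (hG γ v w).2)
    (mapVertices G Δ (γ⁻¹ • ·) fun v w => (hG γ⁻¹ v w).2)
    (hom_ext fun v g => by
      simp only [MonoidHom.comp_apply, mapVertices_of, inv_smul_smul, MonoidHom.id_apply])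
    (hom_ext fun v g => by
      simp only [MonoidHom.comp_apply, mapVertices_of, smul_inv_smul, MonoidHom.id_apply])
  map_one' := by
    apply MulEquiv.toMonoidHom_injective
    refine hom_ext fun v g => ?_
    change mapVertices G Δ ((1 : Γ) • ·) (fun v w => (hG 1 v w).2) (of G Δ v g) = of G Δ v g
    rw [mapVertices_of, one_smul]
  map_mul' γ₁ γ₂ := by
    apply MulEquiv.toMonoidHom_injective
    refine hom_ext fun v g => ?_
    change mapVertices G Δ ((γ₁ * γ₂) • ·) (fun v w => (hG (γ₁ * γ₂) v w).2) (of G Δ v g) =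
      mapVertices G Δ (γ₁ • ·) (fun v w => (hG γ₁ v w).2)
        (mapVertices G Δ (γ₂ • ·) (fun v w => (hG γ₂ v w).2) (of G Δ v g))
    rw [mapVertices_of, mapVertices_of, mapVertices_of, mul_smul]

theorem action_of {V Γ : Type*} [Group Γ] [MulAction Γ V] (G : SimpleGraph V) (Δ : Type*)
    [Group Δ] (hG : ∀ (γ : Γ) (v w : V), G.Adj (γ • v) (γ • w) ↔ G.Adj v w)
    (γ : Γ) (v : V) (g : Δ) :
    action G Δ hG γ (of G Δ v g) = of G Δ (γ • v) g :=
  mapVertices_of G Δ (γ • ·) (fun v w => (hG γ v w).2) v g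

end GraphProduct

/-- The graph wreath product `G(Δ) ⋊ Γ`. -/
abbrev GraphWreathProduct {V Γ : Type*} [Group Γ] [MulAction Γ V] (G : SimpleGraph V)
    (Δ : Type*) [Group Δ]
    (hG : ∀ (γ : Γ) (v w : V), G.Adj (γ • v) (γ • w) ↔ G.Adj v w) : Type _ :=
  SemidirectProduct (GraphProduct G Δ) Γ (GraphProduct.action G Δ hG)

/-! ### Residually finite groups -/

namespace Group

/-! Necessity: a finite quotient of the wreath product identifies `g_(v)` with `g_(kv)` for all `k`
in a finite-index `K ≤ Γ`. Elements such as `a_(v) a_(w)⁻¹`, `[g_(v), h_(v)]` and `[a_(v), a_(w)]`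
would therefore die if `Kv` or `Kw` met a forbidden vertex; keeping them alive forces conditions 2
and 3.

Sufficiency: `GraphWreathProduct.residuallyFinite_of_finite`. An element of `G(Δ)` involves a finite
set `S` of vertices. For small enough `K`, sending the `K`-orbit of each `s ∈ S` to `s` and killing
all other vertices is a `K`-invariant homomorphism onto the graph product over `S` which loses
nothing supported on `S`. This reduces the question to finite graphs.

Finite graphs: induction on the number of vertices. Splitting off one vertex presents the graph
product as a free product of copies of `Δ`, indexed by the cosets of the link subgroup, extended by
the graph product on the other vertices. This is itself a graph wreath product over an edgeless
graph, so the same criterion applies; its inputs are residual finiteness of free products and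
separability of the link subgroup, which is a retract. -/

theorem ResiduallyFinite.of_injective {A B : Type*} [Group A] [Group B] [ResiduallyFinite B]
    (f : A →* B) (hf : Function.Injective f) : ResiduallyFinite A := by
  rw [residuallyFinite_iff_forall_finiteIndexNormalSubgroup]
  intro g hg
  refine hf ?_
  rw [map_one]
  exact eq_one_iff_forall_finiteIndexNormalSubroup (f g) fun K ↦ hg (K.comap f)

theorem ResiduallyFinite.of_leftInverse {A B : Type*} [Group A] [Group B] [ResiduallyFinite B]
    (f : A →* B) (f' : B →* A) (h : f'.comp f = MonoidHom.id A) : ResiduallyFinite A :=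
  .of_injective f (Function.LeftInverse.injective (g := f') fun x => DFunLike.congr_fun h x)

/-- The preimage in `L` of a finite-index subgroup of `B` still has finite index in `A`. This lets
homomorphisms defined only on a finite-index subgroup detect elements. -/
theorem exists_finiteIndex_notMem_of_map_ne_one {A B : Type*} [Group A] [Group B]
    [ResiduallyFinite B] (L : Subgroup A) [L.FiniteIndex] (f : L →* B) (x : L) (hx : f x ≠ 1) :
    ∃ M : Subgroup A, M.FiniteIndex ∧ (x : A) ∉ M := by
  obtain ⟨N, hN, hxN⟩ := residuallyFinite_iff_exists_finiteIndex.1 ‹ResiduallyFinite B› _ hx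
  have hNf : (N.comap f).FiniteIndex := ⟨by
    rw [Subgroup.index_comap]
    exact (N.isFiniteRelIndex_of_finiteIndex (K := f.range)).relIndex_ne_zero⟩
  refine ⟨(N.comap f).map L.subtype, ⟨?_⟩, ?_⟩
  · rw [Subgroup.index_map_subtype]
    exact mul_ne_zero hNf.index_ne_zero Subgroup.FiniteIndex.index_ne_zero
  · rintro ⟨y, hy, hyx⟩
    obtain rfl : y = x := Subtype.ext hyx
    exact hxN hy

/-- Finitely many non-trivial elements of a residually finite group survive in a common finite
quotient. -/
theorem ResiduallyFinite.exists_normal_notMem {A ι : Type*} [Group A] [ResiduallyFinite A]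
    [Finite ι] (g : ι → A) (hg : ∀ i, g i ≠ 1) :
    ∃ N : Subgroup A, N.Normal ∧ N.FiniteIndex ∧ ∀ i, g i ∉ N := by
  choose N hN using fun i => exists_finiteIndexNormalSubgroup_notMem (g i) (hg i)
  refine ⟨⨅ i, (N i).toSubgroup, Subgroup.normal_iInf_normal fun i => inferInstance,
    Subgroup.finiteIndex_iInf fun i => inferInstance, fun i hi => hN i ?_⟩
  exact Subgroup.mem_iInf.1 hi i

end Group

/-! ### Free products -/

/-- A reduced word of length `n` acts on `n + 1` copies of a finite quotient `Q` of `Δ` so that its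
`j`-th letter moves the base point of copy `j + 1` to that of copy `j`. The whole word then moves
the last base point to the first. -/
theorem Monoid.CoprodI.residuallyFinite {ι Δ : Type*} [Group Δ] [Group.ResiduallyFinite Δ] :
    Group.ResiduallyFinite (Monoid.CoprodI fun _ : ι => Δ) := by
  classical
  rw [Group.residuallyFinite_iff_exists_finiteIndex]
  intro x hx
  obtain ⟨w, rfl⟩ : ∃ w : Monoid.CoprodI.Word (fun _ : ι => Δ), w.prod = x :=
    ⟨Monoid.CoprodI.Word.equiv x, Monoid.CoprodI.Word.equiv.left_inv x⟩
  set l := w.toList with hl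
  have hl0 : l.length ≠ 0 := by
    intro h0
    have : w = Monoid.CoprodI.Word.empty :=
      Monoid.CoprodI.Word.ext (List.eq_nil_of_length_eq_zero h0)
    exact hx (by rw [this, Monoid.CoprodI.Word.prod_empty])
  obtain ⟨N, _, _, hN⟩ := Group.ResiduallyFinite.exists_normal_notMem
    (fun j : Fin l.length => (l[j]).2) fun j => w.ne_one _ (List.getElem_mem _)
  have hchain : ∀ (j : ℕ) (hj : j + 1 < l.length), (l[j]).1 ≠ (l[j + 1]).1 :=
    fun j hj => List.isChain_iff_getElem.1 w.chain_ne j hj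
  let Q := Δ ⧸ N
  let X := Fin (l.length + 1) × Q
  -- For each letter `l[j]` of the factor `i`, `σ` carries the base points of copies `j + 1` and `j`
  -- to `1` and `l[j]` in copy `j`, where left multiplication by `l[j]` takes the first to the
  -- second. Sources do not clash because adjacent letters lie in different factors; targets do not
  -- because `l[j] ∉ N`.
  have hσ : ∀ i : ι, ∃ σ : Equiv.Perm X, ∀ a : {j : Fin l.length // (l[j]).1 = i} × Bool,
      σ (if a.2 then (a.1.1.castSucc, 1) else (a.1.1.succ, 1)) =
        (a.1.1.castSucc, if a.2 then ((l[a.1.1]).2 : Q) else 1) := by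
    intro i
    apply Equiv.Perm.exists_extending_pair
    · rintro ⟨⟨⟨j, hj⟩, hji⟩, b⟩ ⟨⟨⟨k, hk⟩, hki⟩, c⟩ h
      have h1 : j ≠ k + 1 := by
        rintro rfl
        exact hchain _ hj (hki.trans hji.symm)
      have h2 : j + 1 ≠ k := by
        rintro rfl
        exact hchain _ hk (hji.trans hki.symm)
      have h := congrArg (fun p : X => (p.1 : ℕ)) h
      cases b <;> cases c <;> simp at h ⊢ <;> omega
    · rintro ⟨⟨j, hji⟩, b⟩ ⟨⟨k, hki⟩, c⟩ h
      obtain ⟨h1, h2⟩ := Prod.ext_iff.1 h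
      obtain rfl : j = k := Fin.castSucc_injective _ h1
      have h3 := hN j
      rw [← QuotientGroup.eq_one_iff] at h3
      cases b <;> cases c <;> simp at h2 ⊢
      · exact h3 h2.symm
      · exact hN j h2
  choose σ hσ using hσ
  let mulQ : Δ →* Equiv.Perm X :=
    { toFun g := Equiv.prodCongr (Equiv.refl _) (Equiv.mulLeft (g : Q))
      map_one' := by ext x <;> simp
      map_mul' := fun g h => by ext x <;> simp [mul_assoc] }
  let θ : ι → Δ →* Equiv.Perm X := fun i => (MulAut.conj (σ i)⁻¹).toMonoidHom.comp mulQ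
  have hstep : ∀ j : Fin l.length, θ (l[j]).1 (l[j]).2 (j.succ, 1) = (j.castSucc, 1) := by
    intro j
    have h1 := hσ (l[j]).1 (⟨j, rfl⟩, false)
    have h2 := hσ (l[j]).1 (⟨j, rfl⟩, true)
    simp only [if_true, Bool.false_eq_true, if_false] at h1 h2
    change (σ (l[j]).1)⁻¹ (mulQ (l[j]).2 ((σ (l[j]).1)⁻¹⁻¹ (j.succ, 1))) = _
    rw [inv_inv, Equiv.Perm.inv_eq_iff_eq, h1, h2]
    exact Prod.ext rfl (mul_one ((l[j]).2 : Q))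
  have hdrop : ∀ (m k : ℕ) (h : k + m = l.length),
      Monoid.CoprodI.lift θ
          ((l.drop k).map fun s => Monoid.CoprodI.of (M := fun _ : ι => Δ) (i := s.1) s.2).prod
        (Fin.last l.length, (1 : Q)) = (⟨k, by omega⟩, (1 : Q)) := by
    intro m
    induction m with
    | zero =>
      intro k h
      obtain rfl : k = l.length := h
      simp [Fin.last]
    | succ m ih =>
      intro k h
      have hk : k < l.length := by omega
      rw [List.drop_eq_getElem_cons hk, List.map_cons, List.prod_cons, map_mul,
        Equiv.Perm.mul_apply, ih (k + 1) (by omega), Monoid.CoprodI.lift_of]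
      exact hstep ⟨k, hk⟩
  have hfin : Finite X := inferInstance
  refine ⟨(Monoid.CoprodI.lift θ).ker, inferInstance, fun hker => ?_⟩
  have h0 := hdrop l.length 0 (by simp)
  rw [List.drop_zero] at h0
  change Monoid.CoprodI.lift θ w.prod _ = _ at h0
  rw [MonoidHom.mem_ker.1 hker] at h0
  have := congrArg (fun p : X => (p.1 : ℕ)) h0
  exact hl0 this

/-- The two sides are distinct reduced words. -/
theorem Monoid.CoprodI.of_mul_of_ne {ι Δ : Type*} [Group Δ] {i j : ι} (hij : i ≠ j) {g h : Δ}
    (hg : g ≠ 1) (hh : h ≠ 1) :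
    (of (M := fun _ : ι => Δ) (i := i) g) * of (M := fun _ : ι => Δ) (i := j) h ≠
      of (M := fun _ : ι => Δ) (i := j) h * of (M := fun _ : ι => Δ) (i := i) g := by
  classical
  let w : ∀ {i j : ι} {g h : Δ}, i ≠ j → g ≠ 1 → h ≠ 1 → Word fun _ : ι => Δ :=
    fun {i j g h} hij hg hh => ⟨[⟨i, g⟩, ⟨j, h⟩], by simp [hg, hh], by simp [hij]⟩
  intro H
  have h2 : (w hij hg hh).prod = (w hij.symm hh hg).prod := by
    simpa [w, Word.prod] using H
  have h3 := congrArg Word.toList (Word.equiv.symm.injective (a₁ := w hij hg hh) (a₂ := w hij.symm hh hg) h2)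
  simp only [w, List.cons.injEq, Sigma.mk.injEq] at h3
  exact hij h3.1.1

/-! ### Homomorphisms out of graph products -/

namespace GraphProduct

/-- The universal property of the graph product. -/
def lift {V Δ M : Type*} {G : SimpleGraph V} [Group Δ] [Group M] (f : V → Δ →* M)
    (hf : ∀ v w, G.Adj v w → ∀ g h, Commute (f v g) (f w h)) : GraphProduct G Δ →* M :=
  QuotientGroup.lift _ (Monoid.CoprodI.lift f) (by
    intro x hx
    refine (Subgroup.normalClosure_le_normal (N := (Monoid.CoprodI.lift f).ker) ?_) hx
    rintro _ ⟨v, w, hvw, g, h, rfl⟩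
    rw [SetLike.mem_coe, MonoidHom.mem_ker, map_commutatorElement, Monoid.CoprodI.lift_of,
      Monoid.CoprodI.lift_of]
    exact commutatorElement_eq_one_iff_commute.2 (hf v w hvw g h))

theorem lift_of {V Δ M : Type*} {G : SimpleGraph V} [Group Δ] [Group M] (f : V → Δ →* M)
    (hf : ∀ v w, G.Adj v w → ∀ g h, Commute (f v g) (f w h)) (v : V) (g : Δ) :
    lift f hf (of G Δ v g) = f v g := by
  change Monoid.CoprodI.lift f (Monoid.CoprodI.of g) = _
  rw [Monoid.CoprodI.lift_of]

theorem commute_of {V : Type*} (G : SimpleGraph V) (Δ : Type*) [Group Δ] {v w : V}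
    (hvw : G.Adj v w) (g h : Δ) : Commute (of G Δ v g) (of G Δ w h) :=
  commutatorElement_eq_one_iff_commute.1 (of_commutator G Δ hvw g h)

theorem induction_on {V Δ : Type*} {G : SimpleGraph V} [Group Δ] {p : GraphProduct G Δ → Prop}
    (x : GraphProduct G Δ) (one : p 1) (of : ∀ v g, p (of G Δ v g))
    (mul : ∀ x y, p x → p y → p (x * y)) : p x := by
  obtain ⟨y, rfl⟩ := QuotientGroup.mk_surjective x
  induction y using Monoid.CoprodI.induction_on with
  | one => exact one
  | of v g => exact of v g
  | mul a b ha hb => exact mul _ _ ha hb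

/-- The homomorphism of graph products induced by a graph homomorphism. -/
def map {V W : Type*} {G : SimpleGraph V} {G' : SimpleGraph W} (Δ : Type*) [Group Δ]
    (f : G →g G') : GraphProduct G Δ →* GraphProduct G' Δ :=
  lift (fun v => of G' Δ (f v)) fun _ _ h => commute_of G' Δ (f.map_rel h)

@[simp]
theorem map_of {V W : Type*} {G : SimpleGraph V} {G' : SimpleGraph W} (Δ : Type*) [Group Δ]
    (f : G →g G') (v : V) (g : Δ) : map Δ f (of G Δ v g) = of G' Δ (f v) g :=
  lift_of _ _ v g

open Classical in
/-- The retraction of a graph product killing the vertex groups outside of `S`. -/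
noncomputable def retract {V Δ : Type*} [Group Δ] (G : SimpleGraph V) (S : Set V) :
    GraphProduct G Δ →* GraphProduct G Δ :=
  lift (fun v => if v ∈ S then of G Δ v else 1) fun v w h g g' => by
    by_cases hv : v ∈ S <;> by_cases hw : w ∈ S <;> simp [hv, hw, commute_of G Δ h]

theorem retract_of_mem {V Δ : Type*} [Group Δ] (G : SimpleGraph V) {S : Set V} {v : V}
    (hv : v ∈ S) (g : Δ) : retract G S (of G Δ v g) = of G Δ v g := by
  rw [retract, lift_of, if_pos hv]

theorem retract_of_notMem {V Δ : Type*} [Group Δ] (G : SimpleGraph V) {S : Set V} {v : V}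
    (hv : v ∉ S) (g : Δ) : retract G S (of G Δ v g) = 1 := by
  rw [retract, lift_of, if_neg hv]; rfl

theorem of_injective {V Δ : Type*} [Group Δ] {G : SimpleGraph V} (v : V) :
    Function.Injective (of G Δ v) := by
  classical
  have h : ∀ a b, G.Adj a b → ∀ g h : Δ,
      Commute ((Pi.mulSingle v (MonoidHom.id Δ) : V → Δ →* Δ) a g)
        ((Pi.mulSingle v (MonoidHom.id Δ) : V → Δ →* Δ) b h) := by
    intro a b hab g h
    by_cases ha : a = v
    · have : b ≠ v := fun hb => hab.ne (ha.trans hb.symm)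
      simp [Pi.mulSingle_eq_of_ne this]
    · simp [Pi.mulSingle_eq_of_ne ha]
  refine Function.LeftInverse.injective (g := lift (Pi.mulSingle v (MonoidHom.id Δ)) h) fun g => ?_
  rw [lift_of, Pi.mulSingle_eq_same]; rfl

theorem of_ne_of {V Δ : Type*} [Group Δ] {G : SimpleGraph V} {v w : V} (hvw : v ≠ w) {g h : Δ}
    (hg : g ≠ 1) : of G Δ v g ≠ of G Δ w h := by
  intro H
  have := congrArg (retract G {v}) H
  rw [retract_of_mem G (Set.mem_singleton v), retract_of_notMem G (by simpa using hvw.symm)] at this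
  exact hg (of_injective v (this.trans (map_one _).symm))

theorem not_commute_of {V Δ : Type*} [Group Δ] {G : SimpleGraph V} {v w : V} (hvw : v ≠ w)
    (hadj : ¬ G.Adj v w) {g h : Δ} (hg : g ≠ 1) (hh : h ≠ 1) :
    ¬ Commute (of G Δ v g) (of G Δ w h) := by
  classical
  -- Killing all vertices but `v` and `w` leaves no relators, so the target can be a free product.
  let f : V → Δ →* Monoid.CoprodI fun _ : V => Δ := fun u =>
    if u = v ∨ u = w then Monoid.CoprodI.of (M := fun _ : V => Δ) (i := u) else 1
  have hf : ∀ a b, G.Adj a b → ∀ g h, Commute (f a g) (f b h) := by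
    intro a b hab g h
    by_cases ha : a = v ∨ a = w
    · have hb : ¬ (b = v ∨ b = w) := by
        rintro (rfl | rfl) <;> obtain rfl | rfl := ha
        · exact hab.ne rfl
        · exact hadj hab.symm
        · exact hadj hab
        · exact hab.ne rfl
      simp [f, hb]
    · simp [f, ha]
  intro H
  have := H.map (lift f hf)
  rw [lift_of, lift_of] at this
  simp only [f, true_or, or_true, if_true] at this
  exact Monoid.CoprodI.of_mul_of_ne hvw hg hh this

theorem residuallyFinite_bot {V Δ : Type*} [Group Δ] [Group.ResiduallyFinite Δ] :
    Group.ResiduallyFinite (GraphProduct (⊥ : SimpleGraph V) Δ) := by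
  have := Monoid.CoprodI.residuallyFinite (ι := V) (Δ := Δ)
  refine .of_leftInverse
    (lift (fun v => Monoid.CoprodI.of (M := fun _ : V => Δ) (i := v)) fun _ _ h => h.elim)
    (QuotientGroup.mk' _) (hom_ext fun v g => ?_)
  rw [MonoidHom.comp_apply, lift_of]
  rfl

end GraphProduct

/-! ### Supports and folding along orbits -/

namespace GraphProduct

/-- The subgroup of a graph product generated by the vertex groups of `S`. -/
def supported {V : Type*} (G : SimpleGraph V) (Δ : Type*) [Group Δ] (S : Set V) :
    Subgroup (GraphProduct G Δ) :=
  Subgroup.closure {x | ∃ v ∈ S, ∃ g, x = of G Δ v g}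

theorem of_mem_supported {V Δ : Type*} [Group Δ] (G : SimpleGraph V) {S : Set V} {v : V}
    (hv : v ∈ S) (g : Δ) : of G Δ v g ∈ supported G Δ S :=
  Subgroup.subset_closure ⟨v, hv, g, rfl⟩

theorem supported_mono {V Δ : Type*} [Group Δ] (G : SimpleGraph V) {S T : Set V} (h : S ⊆ T) :
    supported G Δ S ≤ supported G Δ T :=
  Subgroup.closure_mono fun _ ⟨v, hv, g, hx⟩ => ⟨v, h hv, g, hx⟩

theorem exists_finite_mem_supported {V Δ : Type*} [Group Δ] {G : SimpleGraph V}
    (x : GraphProduct G Δ) : ∃ S : Set V, S.Finite ∧ x ∈ supported G Δ S := by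
  induction x using induction_on with
  | one => exact ⟨∅, Set.finite_empty, one_mem _⟩
  | of v g => exact ⟨{v}, Set.finite_singleton v, of_mem_supported G (Set.mem_singleton v) g⟩
  | mul x y hx hy =>
    obtain ⟨S, hS, hxS⟩ := hx
    obtain ⟨T, hT, hyT⟩ := hy
    exact ⟨S ∪ T, hS.union hT, mul_mem (supported_mono G Set.subset_union_left hxS)
      (supported_mono G Set.subset_union_right hyT)⟩

end GraphProduct

theorem Subgroup.exists_finiteIndex_forall {Γ ι : Type*} [Group Γ] [Finite ι]
    {p : ι → Subgroup Γ → Prop} (hp : ∀ i K L, K ≤ L → p i L → p i K)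
    (h : ∀ i, ∃ K : Subgroup Γ, K.FiniteIndex ∧ p i K) :
    ∃ K : Subgroup Γ, K.FiniteIndex ∧ ∀ i, p i K := by
  choose K hK hpK using h
  exact ⟨⨅ i, K i, Subgroup.finiteIndex_iInf hK, fun i => hp i _ _ (iInf_le K i) (hpK i)⟩

namespace GraphProduct

section OrbitRetract

variable {V Γ Δ : Type*} [Group Γ] [Group Δ] [MulAction Γ V] (G : SimpleGraph V) (S : Set V)
  (K : Subgroup Γ)

/-- The `K`-translates of the vertices in `S` meet only as forced by the induced subgraph on `S`,
up to loops if `Δ` is abelian. -/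
structure OrbitFaithful (Δ : Type*) [Group Δ] : Prop where
  eq_of_mem : ∀ v ∈ S, ∀ w ∈ S, w ∈ MulAction.orbit K v → v = w
  adj_of_adj : ∀ v ∈ S, ∀ w ∈ S, v ≠ w → ∀ u ∈ MulAction.orbit K w, G.Adj v u → G.Adj v w
  commute_of_adj : ∀ v ∈ S, ∀ u ∈ MulAction.orbit K v, G.Adj v u → ∀ g h : Δ, Commute g h

variable {G S K}

open Classical in
/-- Folding of a graph product onto the induced subgraph on `S`: the vertices in the `K`-orbit of
`s ∈ S` are sent to `s`, and the other vertex groups are killed. -/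
noncomputable def orbitRetract
    (hG : ∀ (γ : Γ) (v w : V), G.Adj (γ • v) (γ • w) ↔ G.Adj v w)
    (hK : OrbitFaithful G S K Δ) : GraphProduct G Δ →* GraphProduct (G.induce S) Δ :=
  lift (fun v => if h : ∃ s : S, v ∈ MulAction.orbit K (s : V) then of (G.induce S) Δ h.choose
    else 1) fun v w hvw g g' => by
    by_cases hv : ∃ s : S, v ∈ MulAction.orbit K (s : V)
    swap
    · simp [hv]
    by_cases hw : ∃ s : S, w ∈ MulAction.orbit K (s : V)
    swap
    · simp [hw]
    rw [dif_pos hv, dif_pos hw]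
    obtain ⟨⟨k, hk⟩, hkv⟩ := hv.choose_spec
    obtain ⟨⟨l, hl⟩, hlw⟩ := hw.choose_spec
    generalize hv.choose = s at hkv
    generalize hw.choose = t at hlw
    change k • (s : V) = v at hkv
    change l • (t : V) = w at hlw
    -- Translating the edge by `k⁻¹` puts one end at `s` itself, the only case that `OrbitFaithful`
    -- covers.
    have hadj : G.Adj (s : V) (k⁻¹ • w) := by
      rw [← hG k, smul_inv_smul, hkv]
      exact hvw
    have hmem : k⁻¹ • w ∈ MulAction.orbit K (t : V) :=
      ⟨⟨k⁻¹ * l, mul_mem (inv_mem hk) hl⟩, by rw [← hlw, ← mul_smul]; rfl⟩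
    by_cases hst : s = t
    · subst hst
      exact (hK.commute_of_adj s s.2 _ hmem hadj g g').map _
    · exact commute_of (G.induce S) Δ
        (hK.adj_of_adj s s.2 t t.2 (fun h => hst (Subtype.ext h)) _ hmem hadj) g g'

variable (hG : ∀ (γ : Γ) (v w : V), G.Adj (γ • v) (γ • w) ↔ G.Adj v w)
  (hK : OrbitFaithful G S K Δ)

theorem orbitRetract_of_mem {v : V} (s : S) (h : v ∈ MulAction.orbit K (s : V)) (g : Δ) :
    orbitRetract hG hK (of G Δ v g) = of (G.induce S) Δ s g := by
  have hv : ∃ s : S, v ∈ MulAction.orbit K (s : V) := ⟨s, h⟩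
  rw [orbitRetract, lift_of, dif_pos hv]
  congr
  refine Subtype.ext (hK.eq_of_mem _ hv.choose.2 _ s.2 ?_)
  rw [← MulAction.orbit_eq_iff] at h ⊢
  rw [← h, MulAction.orbit_eq_iff.2 hv.choose_spec]

theorem orbitRetract_of_notMem {v : V} (h : ∀ s : S, v ∉ MulAction.orbit K (s : V)) (g : Δ) :
    orbitRetract hG hK (of G Δ v g) = 1 := by
  rw [orbitRetract, lift_of, dif_neg (by simpa using h)]
  rfl

/-- This invariance lets the folding extend to the preimage of `K` in the wreath product by ignoring
the `Γ`-component. -/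
theorem orbitRetract_action {k : Γ} (hk : k ∈ K) (x : GraphProduct G Δ) :
    orbitRetract hG hK (action G Δ hG k x) = orbitRetract hG hK x := by
  have hmem : ∀ (v : V) (s : S), k • v ∈ MulAction.orbit K (s : V) ↔
      v ∈ MulAction.orbit K (s : V) := fun v s => by
    rw [← MulAction.orbit_eq_iff, ← MulAction.orbit_eq_iff, ← MulAction.orbit_smul (⟨k, hk⟩ : K) v]
    rfl
  suffices (orbitRetract hG hK).comp (action G Δ hG k).toMonoidHom = orbitRetract hG hK from
    DFunLike.congr_fun this x
  refine hom_ext fun v g => ?_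
  rw [MonoidHom.comp_apply]
  change orbitRetract hG hK (action G Δ hG k (of G Δ v g)) = _
  rw [action_of]
  by_cases hv : ∃ s : S, v ∈ MulAction.orbit K (s : V)
  · obtain ⟨s, hs⟩ := hv
    rw [orbitRetract_of_mem hG hK s hs, orbitRetract_of_mem hG hK s ((hmem v s).2 hs)]
  · have h := not_exists.1 hv
    rw [orbitRetract_of_notMem hG hK h,
      orbitRetract_of_notMem hG hK fun s => mt (hmem v s).1 (h s)]

/-- Hence folding is injective on elements supported on `S`. -/
theorem map_orbitRetract_of_mem_supported {x : GraphProduct G Δ} (hx : x ∈ supported G Δ S) :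
    map Δ (SimpleGraph.Embedding.induce (G := G) S).toHom (orbitRetract hG hK x) = x := by
  suffices Set.EqOn ((map Δ (SimpleGraph.Embedding.induce (G := G) S).toHom).comp
      (orbitRetract hG hK)) (MonoidHom.id _) (supported G Δ S) from this hx
  refine MonoidHom.eqOn_closure ?_
  rintro _ ⟨v, hv, g, rfl⟩
  rw [MonoidHom.comp_apply, orbitRetract_of_mem hG hK ⟨v, hv⟩ (MulAction.mem_orbit_self v),
    map_of]
  rfl

end OrbitRetract

end GraphProduct

/-! ### The sufficient criterion -/

open GraphProduct in
/-- A graph wreath product is residually finite if the graph products over finite induced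
subgraphs are and the orbits of finite-index subgroups separate the relevant vertices. -/
theorem GraphWreathProduct.residuallyFinite_of_finite {V Γ Δ : Type*} [Group Γ] [Group Δ]
    [MulAction Γ V] (G : SimpleGraph V)
    (hG : ∀ (γ : Γ) (v w : V), G.Adj (γ • v) (γ • w) ↔ G.Adj v w) [Group.ResiduallyFinite Γ]
    (hfin : ∀ S : Set V, S.Finite → Group.ResiduallyFinite (GraphProduct (G.induce S) Δ))
    (hloop : ∀ v : V, ∃ K : Subgroup Γ, K.FiniteIndex ∧
      ∀ u ∈ MulAction.orbit K v, G.Adj v u → ∀ g h : Δ, Commute g h)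
    (heq : ∀ v w : V, v ≠ w → ∃ K : Subgroup Γ, K.FiniteIndex ∧ w ∉ MulAction.orbit K v)
    (hadj : ∀ v w, v ≠ w → ¬ G.Adj v w → ∃ K : Subgroup Γ, K.FiniteIndex ∧
      ∀ u ∈ MulAction.orbit K w, ¬ G.Adj v u) :
    Group.ResiduallyFinite (GraphWreathProduct G Δ hG) := by
  rw [Group.residuallyFinite_iff_exists_finiteIndex]
  rintro ⟨x, γ⟩ hx
  by_cases hγ : γ = 1
  swap
  · exact Group.exists_finiteIndex_notMem_of_map_ne_one (⊤ : Subgroup _)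
      (SemidirectProduct.rightHom.comp (Subgroup.subtype _)) ⟨⟨x, γ⟩, trivial⟩ hγ
  subst hγ
  have hx1 : x ≠ 1 := by
    rintro rfl
    exact hx rfl
  obtain ⟨S, hS, hxS⟩ := exists_finite_mem_supported x
  have := hS.to_subtype
  have horb : ∀ (v : V) (K L : Subgroup Γ), K ≤ L →
      MulAction.orbit K v ⊆ MulAction.orbit L v := by
    rintro v K L h _ ⟨⟨k, hk⟩, rfl⟩
    exact ⟨⟨k, h hk⟩, rfl⟩
  obtain ⟨K, hK, hKp⟩ : ∃ K : Subgroup Γ, K.FiniteIndex ∧ ∀ q : S × S,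
      (∀ u ∈ MulAction.orbit K (q.1 : V), G.Adj q.1 u → ∀ g h : Δ, Commute g h) ∧
      ((q.1 : V) ≠ q.2 → (q.2 : V) ∉ MulAction.orbit K (q.1 : V)) ∧
      ((q.1 : V) ≠ q.2 → ¬ G.Adj q.1 q.2 →
        ∀ u ∈ MulAction.orbit K (q.2 : V), ¬ G.Adj q.1 u) := by
    refine Subgroup.exists_finiteIndex_forall (fun q K L hKL ⟨h1, h2, h3⟩ => ⟨?_, ?_, ?_⟩) ?_
    · exact fun u hu => h1 u (horb _ _ _ hKL hu)
    · exact fun hne hu => h2 hne (horb _ _ _ hKL hu)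
    · exact fun hne ha u hu => h3 hne ha u (horb _ _ _ hKL hu)
    rintro ⟨v, w⟩
    obtain ⟨K₁, hK₁, h₁⟩ := hloop v
    obtain ⟨K₂, hK₂, h₂⟩ : ∃ K : Subgroup Γ, K.FiniteIndex ∧
        ((v : V) ≠ w → (w : V) ∉ MulAction.orbit K (v : V)) := by
      by_cases h : (v : V) = w
      · exact ⟨⊤, inferInstance, fun h' => (h' h).elim⟩
      · exact (heq v w h).imp fun K hK => ⟨hK.1, fun _ => hK.2⟩
    obtain ⟨K₃, hK₃, h₃⟩ : ∃ K : Subgroup Γ, K.FiniteIndex ∧ ((v : V) ≠ w → ¬ G.Adj v w →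
        ∀ u ∈ MulAction.orbit K (w : V), ¬ G.Adj v u) := by
      by_cases h : (v : V) ≠ w ∧ ¬ G.Adj v w
      · exact (hadj v w h.1 h.2).imp fun K hK => ⟨hK.1, fun _ _ => hK.2⟩
      · exact ⟨⊤, inferInstance, fun h' h'' => (h ⟨h', h''⟩).elim⟩
    refine ⟨K₁ ⊓ K₂ ⊓ K₃, inferInstance, fun u hu => h₁ u (horb _ _ _ ?_ hu),
      fun hne hu => h₂ hne (horb _ _ _ ?_ hu), fun hne ha u hu => h₃ hne ha u (horb _ _ _ ?_ hu)⟩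
    · exact inf_le_left.trans inf_le_left
    · exact inf_le_left.trans inf_le_right
    · exact inf_le_right
  have hKS : OrbitFaithful G S K Δ :=
    { eq_of_mem v hv w hw h := by
        by_contra hne
        exact (hKp (⟨v, hv⟩, ⟨w, hw⟩)).2.1 hne h
      adj_of_adj v hv w hw hne u hu ha := by
        by_contra hna
        exact (hKp (⟨v, hv⟩, ⟨w, hw⟩)).2.2 hne hna u hu ha
      commute_of_adj v hv := (hKp (⟨v, hv⟩, ⟨v, hv⟩)).1 }
  have hRF := hfin S hS
  -- Multiplicative because the twist by `k ∈ K` in the semidirect product is invisible after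
  -- folding.
  let f : (K.comap SemidirectProduct.rightHom : Subgroup (GraphWreathProduct G Δ hG)) →*
      GraphProduct (G.induce S) Δ :=
    MonoidHom.mk' (fun y => orbitRetract hG hKS (y : GraphWreathProduct G Δ hG).left) (by
      rintro ⟨⟨a, k⟩, hk⟩ ⟨⟨b, l⟩, hl⟩
      change orbitRetract hG hKS (a * action G Δ hG k b) = _
      rw [map_mul, orbitRetract_action hG hKS (show k ∈ K from hk)])
  have hfi : (K.comap SemidirectProduct.rightHom :
      Subgroup (GraphWreathProduct G Δ hG)).FiniteIndex := ⟨by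
    rw [Subgroup.index_comap]
    exact (K.isFiniteRelIndex_of_finiteIndex
      (K := SemidirectProduct.rightHom.range)).relIndex_ne_zero⟩
  refine Group.exists_finiteIndex_notMem_of_map_ne_one _ f ⟨⟨x, 1⟩, K.one_mem⟩ fun h => hx1 ?_
  change orbitRetract hG hKS x = 1 at h
  rw [← map_orbitRetract_of_mem_supported hG hKS hxS, h, map_one]

/-! ### Splitting off a vertex; finite graphs -/

/-- An element of a residually finite group that is not fixed by an endomorphism stays non-fixed
after multiplication by elements of a suitable finite-index normal subgroup. -/
theorem Group.ResiduallyFinite.exists_normal_mul_notMem_fixed {A : Type*} [Group A]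
    [Group.ResiduallyFinite A] (ρ : A →* A) {y : A} (hy : ρ y ≠ y) :
    ∃ K : Subgroup A, K.Normal ∧ K.FiniteIndex ∧ ∀ k ∈ K, ρ (k * y) ≠ k * y := by
  obtain ⟨N, hN⟩ := Group.exists_finiteIndexNormalSubgroup_of_residuallyFinite _ _ hy
  let p : A →* A ⧸ N.toSubgroup := QuotientGroup.mk' _
  -- Modulo `N`, multiplying `y` by such a `k` changes neither `y` nor `ρ y`.
  refine ⟨p.ker ⊓ (p.comp ρ).ker, inferInstance, inferInstance, ?_⟩
  rintro k ⟨h1, h2⟩ h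
  apply hN
  have h3 := congrArg p h
  rw [map_mul, map_mul, map_mul, show p k = 1 from h1, show p (ρ k) = 1 from h2, one_mul,
    one_mul] at h3
  exact h3

namespace GraphProduct

section Vertex

variable {α Δ : Type*} [Group Δ] (G : SimpleGraph (Option α))

/-- The subgroup of the graph product over the vertices other than `none` fixed by the retraction
onto the link of `none`. -/
noncomputable def linkSubgroup (Δ : Type*) [Group Δ] :
    Subgroup (GraphProduct (G.comap some) Δ) :=
  (retract (G.comap some) {a | G.Adj none (some a)}).eqLocus (MonoidHom.id _)

/-- The inclusion of the graph product over the vertices other than `none`. -/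
def inclSome (Δ : Type*) [Group Δ] : GraphProduct (G.comap some) Δ →* GraphProduct G Δ :=
  map Δ ⟨some, id⟩

theorem inclSome_of (a : α) (g : Δ) :
    inclSome G Δ (of (G.comap some) Δ a g) = of G Δ (some a) g :=
  map_of _ _ a g

theorem commute_inclSome_linkSubgroup {c : GraphProduct (G.comap some) Δ}
    (hc : c ∈ linkSubgroup G Δ) (g : Δ) : Commute (inclSome G Δ c) (of G Δ none g) := by
  set ρ := retract (Δ := Δ) (G.comap some) {a | G.Adj none (some a)} with hρ
  -- After composing with `ρ` the claim can be checked on generators, and `c` is fixed by `ρ`. No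
  -- generating set of the link subgroup is needed.
  have hcomm : ((MulAut.conj (of G Δ none g)).toMonoidHom.comp (inclSome G Δ)).comp ρ =
      (inclSome G Δ).comp ρ := by
    refine hom_ext fun a h => ?_
    change of G Δ none g * inclSome G Δ (ρ (of _ Δ a h)) * (of G Δ none g)⁻¹ =
      inclSome G Δ (ρ (of _ Δ a h))
    by_cases ha : a ∈ {a | G.Adj none (some a)}
    · rw [hρ, retract_of_mem _ ha, inclSome_of, (commute_of G Δ ha g h).eq, mul_inv_cancel_right]
    · rw [hρ, retract_of_notMem _ ha, map_one, mul_one, mul_inv_cancel]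
  have h := DFunLike.congr_fun hcomm c
  change of G Δ none g * inclSome G Δ (ρ c) * (of G Δ none g)⁻¹ = inclSome G Δ (ρ c) at h
  rw [show ρ c = c from hc] at h
  exact (mul_inv_eq_iff_eq_mul.1 h).symm

theorem of_mem_linkSubgroup {a : α} (ha : G.Adj none (some a)) (g : Δ) :
    of (G.comap some) Δ a g ∈ linkSubgroup G Δ :=
  retract_of_mem (G.comap some) (S := {a | G.Adj none (some a)}) ha g

/-- The cosets of the link subgroup. -/
abbrev LinkCoset (Δ : Type*) [Group Δ] : Type _ :=
  GraphProduct (G.comap some) Δ ⧸ linkSubgroup G Δ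

theorem smul_adj_bot (h : GraphProduct (G.comap some) Δ) (v w : LinkCoset G Δ) :
    (⊥ : SimpleGraph (LinkCoset G Δ)).Adj (h • v) (h • w) ↔
      (⊥ : SimpleGraph (LinkCoset G Δ)).Adj v w :=
  Iff.rfl

/-- The wreath product of the graph product over the vertices other than `none` with a free
product of copies of the group at `none`, indexed by the cosets of the link subgroup. -/
abbrev VertexWreath (Δ : Type*) [Group Δ] : Type _ :=
  GraphWreathProduct (⊥ : SimpleGraph (LinkCoset G Δ)) Δ (smul_adj_bot G)

/-- The copy of the group at `none` indexed by the trivial coset. -/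
noncomputable def baseCopy (Δ : Type*) [Group Δ] : Δ →* VertexWreath G Δ :=
  SemidirectProduct.inl.comp
    (of (⊥ : SimpleGraph (LinkCoset G Δ)) Δ ((1 : GraphProduct (G.comap some) Δ) : LinkCoset G Δ))

/-- The graph product over the vertices other than `none`, inside the wreath product. -/
noncomputable def complement (Δ : Type*) [Group Δ] : GraphProduct (G.comap some) Δ →* VertexWreath G Δ :=
  SemidirectProduct.inr

theorem commute_baseCopy_complement {c : GraphProduct (G.comap some) Δ}
    (hc : c ∈ linkSubgroup G Δ) (g : Δ) : Commute (baseCopy G Δ g) (complement G Δ c) := by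
  have h := SemidirectProduct.inl_aut
    (φ := action (⊥ : SimpleGraph (LinkCoset G Δ)) Δ (smul_adj_bot G)) c
    (of _ Δ ((1 : GraphProduct (G.comap some) Δ) : LinkCoset G Δ) g)
  have hc' : c • ((1 : GraphProduct (G.comap some) Δ) : LinkCoset G Δ) =
      ((1 : GraphProduct (G.comap some) Δ) : LinkCoset G Δ) := by
    rw [MulAction.Quotient.smul_coe, smul_eq_mul, mul_one]
    exact QuotientGroup.eq.2 (by rw [mul_one]; exact inv_mem hc)
  rw [action_of, hc', map_inv] at h
  exact eq_mul_inv_iff_mul_eq.1 h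

/-- The decomposition of a graph product at the vertex `none`. -/
noncomputable def toVertexWreath : GraphProduct G Δ →* VertexWreath G Δ :=
  lift (fun v => v.elim (baseCopy G Δ) fun a => (complement G Δ).comp (of (G.comap some) Δ a)) (by
    rintro (_ | a) (_ | b) hab g h
    · exact (hab.ne rfl).elim
    · exact commute_baseCopy_complement G (of_mem_linkSubgroup G hab h) g
    · exact (commute_baseCopy_complement G (of_mem_linkSubgroup G hab.symm g) h).symm
    · have h := (commute_of (G.comap some) Δ (v := a) (w := b) hab g h).map (complement G Δ)
      exact h)

theorem toVertexWreath_of_none (g : Δ) :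
    toVertexWreath G (of G Δ none g) = baseCopy G Δ g :=
  lift_of _ _ _ g

theorem toVertexWreath_of_some (a : α) (g : Δ) :
    toVertexWreath G (of G Δ (some a) g) = complement G Δ (of (G.comap some) Δ a g) :=
  lift_of _ _ _ g

/-- Makes conjugates of the group at `none` depend only on the coset, so that they can be indexed by
`LinkCoset`. -/
theorem conj_inclSome_eq {x y : GraphProduct (G.comap some) Δ}
    (h : (x : LinkCoset G Δ) = y) (g : Δ) :
    inclSome G Δ x * of G Δ none g * (inclSome G Δ x)⁻¹ =
      inclSome G Δ y * of G Δ none g * (inclSome G Δ y)⁻¹ := by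
  have hc := (commute_inclSome_linkSubgroup G (QuotientGroup.eq.1 h) g).eq
  obtain ⟨c, rfl⟩ : ∃ c, y = x * c := ⟨x⁻¹ * y, by group⟩
  rw [inv_mul_cancel_left] at hc
  rw [map_mul, mul_inv_rev, mul_assoc (inclSome G Δ x) (inclSome G Δ c), hc]
  group

/-- The free product of the conjugates of the group at `none`. -/
noncomputable def conjugates (Δ : Type*) [Group Δ] :
    GraphProduct (⊥ : SimpleGraph (LinkCoset G Δ)) Δ →* GraphProduct G Δ :=
  lift (fun q => (MulAut.conj (inclSome G Δ q.out)).toMonoidHom.comp (of G Δ none))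
    fun _ _ h => h.elim

theorem conjugates_of (x : GraphProduct (G.comap some) Δ) (g : Δ) :
    conjugates G Δ (of _ Δ (x : LinkCoset G Δ) g) =
      inclSome G Δ x * of G Δ none g * (inclSome G Δ x)⁻¹ :=
  (lift_of _ _ _ g).trans (conj_inclSome_eq G (QuotientGroup.out_eq' _) g)

/-- The inverse of the decomposition of a graph product at the vertex `none`. -/
noncomputable def ofVertexWreath : VertexWreath G Δ →* GraphProduct G Δ :=
  SemidirectProduct.lift (conjugates G Δ) (inclSome G Δ) (by
    intro h
    refine hom_ext fun q g => ?_
    induction q using QuotientGroup.induction_on with | _ x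
    change conjugates G Δ (action _ Δ (smul_adj_bot G) h (of _ Δ (x : LinkCoset G Δ) g)) =
      inclSome G Δ h * conjugates G Δ (of _ Δ (x : LinkCoset G Δ) g) * (inclSome G Δ h)⁻¹
    rw [action_of, MulAction.Quotient.smul_coe, smul_eq_mul, conjugates_of, conjugates_of]
    simp only [map_mul, mul_inv_rev, mul_assoc])

/-- This one-sided identity already embeds the graph product in the wreath product, which suffices
for residual finiteness. -/
theorem ofVertexWreath_comp_toVertexWreath :
    (ofVertexWreath G (Δ := Δ)).comp (toVertexWreath G) = MonoidHom.id _ := by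
  refine hom_ext fun v g => ?_
  rw [MonoidHom.comp_apply, MonoidHom.id_apply]
  cases v with
  | none =>
    rw [toVertexWreath_of_none, ofVertexWreath, baseCopy, MonoidHom.comp_apply,
      SemidirectProduct.lift_inl, conjugates_of, map_one, one_mul, inv_one, mul_one]
  | some a =>
    rw [toVertexWreath_of_some, ofVertexWreath, complement, SemidirectProduct.lift_inr, inclSome_of]

theorem residuallyFinite_option [Group.ResiduallyFinite Δ]
    [Group.ResiduallyFinite (GraphProduct (G.comap some) Δ)] :
    Group.ResiduallyFinite (GraphProduct G Δ) := by
  -- The link subgroup is the fixed set of a retraction, hence closed in the profinite topology;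
  -- this separates its cosets.
  have hsep : ∀ v w : LinkCoset G Δ, v ≠ w →
      ∃ K : Subgroup (GraphProduct (G.comap some) Δ), K.FiniteIndex ∧
        w ∉ MulAction.orbit K v := by
    intro v w
    induction v using QuotientGroup.induction_on with | _ x
    induction w using QuotientGroup.induction_on with | _ y
    intro hne
    obtain ⟨K, hK, hKf, hKy⟩ := Group.ResiduallyFinite.exists_normal_mul_notMem_fixed
      (retract (G.comap some) {a | G.Adj none (some a)}) (y := y⁻¹ * x)
      fun h => hne (QuotientGroup.eq (s := linkSubgroup G Δ).2 h).symm
    refine ⟨K, hKf, ?_⟩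
    rintro ⟨⟨k, hk⟩, h⟩
    have h' : y⁻¹ * (k * x) ∈ linkSubgroup G Δ := QuotientGroup.eq.1 h.symm
    -- Normality of `K` moves `k` past `y⁻¹`.
    refine hKy (y⁻¹ * k * y) (by simpa using hK.conj_mem k hk y⁻¹) ?_
    rw [show y⁻¹ * k * y * (y⁻¹ * x) = y⁻¹ * (k * x) by group]
    exact h'
  have : Group.ResiduallyFinite (VertexWreath G Δ) :=
    GraphWreathProduct.residuallyFinite_of_finite _ _ (fun _ _ => residuallyFinite_bot)
      (fun _ => ⟨⊤, inferInstance, fun _ _ h => h.elim⟩) hsep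
      (fun _ _ _ _ => ⟨⊤, inferInstance, fun _ _ h => h⟩)
  exact .of_leftInverse _ _ (ofVertexWreath_comp_toVertexWreath G)

end Vertex

/-- Graph products of residually finite groups over finite graphs are residually finite. -/
theorem residuallyFinite_of_finite {V Δ : Type*} [Finite V] [Group Δ] [Group.ResiduallyFinite Δ]
    (G : SimpleGraph V) : Group.ResiduallyFinite (GraphProduct G Δ) := by
  induction V using Finite.induction_empty_option with
  | of_equiv e ih =>
    have := ih (G.comap e)
    refine .of_leftInverse (map Δ (SimpleGraph.Iso.comap e G).symm.toHom)
      (map Δ (SimpleGraph.Iso.comap e G).toHom) (hom_ext fun v g => ?_)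
    simp
  | h_empty =>
    rw [show G = ⊥ from Subsingleton.elim _ _]
    exact residuallyFinite_bot
  | h_option ih =>
    have := ih (G.comap some)
    exact residuallyFinite_option G

end GraphProduct

/-! ### Necessity and the main theorem -/

theorem GraphWreathProduct.map_inl_of_smul {V Γ Δ H : Type*} [Group Γ] [Group Δ] [Group H]
    [MulAction Γ V] (G : SimpleGraph V)
    (hG : ∀ (γ : Γ) (v w : V), G.Adj (γ • v) (γ • w) ↔ G.Adj v w)
    (f : GraphWreathProduct G Δ hG →* H) {γ : Γ} (hγ : f (SemidirectProduct.inr γ) = 1)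
    (v : V) (g : Δ) :
    f (SemidirectProduct.inl (GraphProduct.of G Δ (γ • v) g)) =
      f (SemidirectProduct.inl (GraphProduct.of G Δ v g)) := by
  rw [← GraphProduct.action_of G Δ hG, SemidirectProduct.inl_aut, map_mul, map_mul, map_inv,
    map_inv, hγ, one_mul, inv_one, mul_one]

/-- Non-trivial elements of `G(Δ)` survive in a finite quotient of the graph wreath product, on
which a finite-index subgroup of `Γ` does not affect the vertex groups. -/
theorem GraphWreathProduct.exists_map_ne_one {V Γ : Type*} {Δ : Type*} [Group Γ] [Group Δ]
    [MulAction Γ V] (G : SimpleGraph V)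
    (hG : ∀ (γ : Γ) (v w : V), G.Adj (γ • v) (γ • w) ↔ G.Adj v w)
    [Group.ResiduallyFinite (GraphWreathProduct G Δ hG)] {x : GraphProduct G Δ} (hx : x ≠ 1) :
    ∃ (N : Subgroup (GraphWreathProduct G Δ hG)) (_ : N.Normal) (K : Subgroup Γ),
      K.FiniteIndex ∧
      ∃ f : GraphProduct G Δ →* GraphWreathProduct G Δ hG ⧸ N, f x ≠ 1 ∧
      ∀ (v : V), ∀ u ∈ MulAction.orbit K v, ∀ g : Δ,
        f (GraphProduct.of G Δ u g) = f (GraphProduct.of G Δ v g) := by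
  obtain ⟨N, hN⟩ := Group.exists_finiteIndexNormalSubgroup_notMem
    (SemidirectProduct.inl x : GraphWreathProduct G Δ hG)
    fun h => hx (SemidirectProduct.inl_injective (h.trans (map_one _).symm))
  let p := QuotientGroup.mk' N.toSubgroup
  refine ⟨N.toSubgroup, inferInstance, (p.comp SemidirectProduct.inr).ker, inferInstance,
    p.comp SemidirectProduct.inl, fun h => hN ((QuotientGroup.eq_one_iff _).1 h), ?_⟩
  rintro v _ ⟨⟨k, hk⟩, rfl⟩ g
  exact map_inl_of_smul G hG p hk v g

theorem theorem1p1 {V Γ Δ : Type*} [Nonempty V] [Group Γ] [Group Δ] [Nontrivial Δ]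
    [MulAction Γ V] (G : SimpleGraph V)
    (hG : ∀ (γ : Γ) (v w : V), G.Adj (γ • v) (γ • w) ↔ G.Adj v w) :
    Group.ResiduallyFinite (GraphWreathProduct G Δ hG) ↔
      (Group.ResiduallyFinite Γ ∧ Group.ResiduallyFinite Δ) ∧
      (((∀ g h : Δ, g * h = h * g) ∧
          ∀ v w : V, G.Adj v w →
            ∃ K : Subgroup Γ, K.FiniteIndex ∧ w ∉ MulAction.orbit K v) ∨
        ∀ v : V, ∃ K : Subgroup Γ, K.FiniteIndex ∧
          MulAction.orbit K v ∩ G.neighborSet v = ∅) ∧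
      (∀ v w : V, v ≠ w → ¬ G.Adj v w →
        ∃ K : Subgroup Γ, K.FiniteIndex ∧
          MulAction.orbit K w ∩ (G.neighborSet v ∪ {v}) = ∅) := by
  constructor
  · intro hW
    obtain ⟨a, ha⟩ := exists_ne (1 : Δ)
    refine ⟨⟨.of_injective SemidirectProduct.inr (SemidirectProduct.inr_injective
      (φ := GraphProduct.action G Δ hG)), ?_⟩, ?_, ?_⟩
    · obtain ⟨v⟩ := ‹Nonempty V›
      exact .of_injective ((SemidirectProduct.inl (φ := GraphProduct.action G Δ hG)).comp
        (GraphProduct.of G Δ v))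
        (SemidirectProduct.inl_injective.comp (GraphProduct.of_injective v))
    · by_cases hab : ∀ g h : Δ, g * h = h * g
      · refine Or.inl ⟨hab, fun v w hvw => ?_⟩
        obtain ⟨N, _, K, hK, f, hf, hfK⟩ := GraphWreathProduct.exists_map_ne_one G hG
          (mt mul_inv_eq_one.1 (GraphProduct.of_ne_of (G := G) (h := a) hvw.ne ha))
        refine ⟨K, hK, fun hw => hf ?_⟩
        rw [map_mul, map_inv, hfK v w hw, mul_inv_cancel]
      · push Not at hab
        obtain ⟨g, h, hgh⟩ := hab
        refine Or.inr fun v => ?_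
        obtain ⟨N, _, K, hK, f, hf, hfK⟩ := GraphWreathProduct.exists_map_ne_one G hG
          (x := ⁅GraphProduct.of G Δ v g, GraphProduct.of G Δ v h⁆) (by
            rw [← map_commutatorElement, Ne, map_eq_one_iff _ (GraphProduct.of_injective v),
              commutatorElement_eq_one_iff_mul_comm]
            exact hgh)
        refine ⟨K, hK, Set.eq_empty_iff_forall_notMem.2 fun u ⟨hu, hvu⟩ => hf ?_⟩
        -- In the quotient `h_(v)` equals `h_(u)`, and `u` is a neighbour of `v`, so the commutator
        -- dies.
        rw [map_commutatorElement, ← hfK v u hu h, ← map_commutatorElement,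
          GraphProduct.of_commutator G Δ hvu, map_one]
    · intro v w hvw hadj
      obtain ⟨N, _, K, hK, f, hf, hfK⟩ := GraphWreathProduct.exists_map_ne_one G hG
        (mt commutatorElement_eq_one_iff_commute.1 (GraphProduct.not_commute_of hvw hadj ha ha))
      refine ⟨K, hK, Set.eq_empty_iff_forall_notMem.2 ?_⟩
      rintro u ⟨hu, hvu | rfl⟩ <;> apply hf
      · rw [map_commutatorElement, ← hfK w u hu a, ← map_commutatorElement,
          GraphProduct.of_commutator G Δ hvu, map_one]
      · rw [map_commutatorElement, hfK w u hu a, commutatorElement_self]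
  · rintro ⟨⟨hΓ, hΔ⟩, h2, h3⟩
    refine GraphWreathProduct.residuallyFinite_of_finite G hG (fun S hS => ?_) ?_ ?_ ?_
    · have := hS.to_subtype
      exact GraphProduct.residuallyFinite_of_finite _
    · intro v
      obtain ⟨hab, -⟩ | h2 := h2
      · exact ⟨⊤, inferInstance, fun _ _ _ => hab⟩
      · obtain ⟨K, hK, h⟩ := h2 v
        exact ⟨K, hK, fun u hu hvu => (Set.eq_empty_iff_forall_notMem.1 h u ⟨hu, hvu⟩).elim⟩
    · intro v w hne
      by_cases hvw : G.Adj v w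
      · obtain ⟨-, h2⟩ | h2 := h2
        · exact h2 v w hvw
        · obtain ⟨K, hK, h⟩ := h2 v
          exact ⟨K, hK, fun hw => Set.eq_empty_iff_forall_notMem.1 h w ⟨hw, hvw⟩⟩
      -- Here only the part `v ∉ Kw` of condition 3 matters; it is the same as `w ∉ Kv`.
      · obtain ⟨K, hK, h⟩ := h3 v w hne hvw
        exact ⟨K, hK, fun hw => Set.eq_empty_iff_forall_notMem.1 h v
          ⟨MulAction.mem_orbit_symm.1 hw, Or.inr rfl⟩⟩
    · intro v w hne hvw
      obtain ⟨K, hK, h⟩ := h3 v w hne hvw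
      exact ⟨K, hK, fun u hu hvu => Set.eq_empty_iff_forall_notMem.1 h u ⟨hu, Or.inl hvu⟩⟩
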